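/- All proofs normalize modulo $\equiv_{HA}$, for predicative as well as for impredicative arithmetic. In detail: \textbf{Deduction modulo.} Work in many-sorted intuitionistic first-order logic with $\top,\bot,\wedge,\vee,\Rightarrow,\forall,\exists$. The congruence $\equiv_{\mathcal R}$ defined by a set $\mathcal R$ of rewrite rules is the smallest equivalence relation on terms and on propositions that contains all pairs $\sigma l\equiv\sigma r$ ($l\to r$ a rule of $\mathcal R$, $\sigma$ a substitution) and is compatible with function symbols, predicate symbols, connectives and quantifiers. Natural deduction modulo $\equiv$ is intuitionistic natural deduction in which each rule is applied up to $\equiv$ (for instance: from $\Gamma\vdash C$ and $\Gamma\vdash A$ infer $\Gamma\vdash B$ if $C\equiv (A\Rightarrow B)$). Proofs are written as proof-terms $$\pi ::= \alpha\mid I\mid\delta_\bot(\pi)\mid\langle\pi_1,\pi_2\rangle\mid \mathit{fst}(\pi)\mid \mathit{snd}(\pi)\mid i(\pi)\mid j(\pi)\mid\delta(\pi_1,\alpha\,\pi_2,\beta\,\pi_3)\mid\lambda\alpha\,\pi\mid(\pi_1\,\pi_2)\mid\lambda x\,\pi\mid(\pi\,t)\mid\langle t,\pi\rangle\mid\delta_\exists(\pi_1,x\alpha\,\pi_2),$$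 one construction for each deduction rule. Reduction $\triangleright$ consists of the following rules, applied anywhere in a proof-term: $\mathit{fst}(\langle\pi_1,\pi_2\rangle)\triangleright\pi_1$, $\mathit{snd}(\langle\pi_1,\pi_2\rangle)\triangleright\pi_2$, $\delta(i(\pi_1),\alpha\,\pi_2,\beta\,\pi_3)\triangleright(\pi_1/\alpha)\pi_2$, $\delta(j(\pi_1),\alpha\,\pi_2,\beta\,\pi_3)\triangleright(\pi_1/\beta)\pi_3$, $(\lambda\alpha\,\pi_1\ \pi_2)\triangleright(\pi_2/\alpha)\pi_1$, $(\lambda x\,\pi\ t)\triangleright(t/x)\pi$, $\delta_\exists(\langle t,\pi_1\rangle,x\alpha\,\pi_2)\triangleright(t/x,\pi_1/\alpha)\pi_2$. A proof-term is strongly normalizing if its reduction tree is finite. \textbf{Arithmetic.} There are two sorts, $\iota$ (numbers) and $\kappa$ (classes). The base language has the function symbols $0$, $S$, $\mathit{Pred}$, $+$, $\times$ on $\iota$, the predicate symbols $=$ (rank $\langle\iota,\iota\rangle$), $N$ and $\mathit{Null}$ (rank $\langle\iota\rangle$) and $\epsilon$ (rank $\langle\iota,\kappa\rangle$), and variables and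 quantifiers of both sorts. The full language adds, for every admissible choice of distinct variables $x,y_1,\dots,y_n$ with $x$ of sort $\iota$ and of a proposition $A$ of the base language with free variables among $x,y_1,\dots,y_n$, a function symbol $f_{x,y_1,\dots,y_n,A}$ of rank $\langle s_1,\dots,s_n,\kappa\rangle$, where $s_i$ is the sort of $y_i$. In impredicative arithmetic every choice is admissible; in predicative arithmetic only those in which $A$ contains neither $\epsilon$ nor quantifiers over classes and all $y_i$ have sort $\iota$. The rewrite system $HA$ consists of the rules $$x\,\epsilon\, f_{x,y_1,\dots,y_n,A}(y_1,\dots,y_n)\to A,\qquad y=z\to\forall X\,(y\,\epsilon\, X\Rightarrow z\,\epsilon\, X),$$ $$N(n)\to\forall X\,(0\,\epsilon\, X\Rightarrow\forall y\,(N(y)\Rightarrow y\,\epsilon\, X\Rightarrow S(y)\,\epsilon\, X)\Rightarrow n\,\epsilon\, X),$$ $$\mathit{Null}(0)\to\top,\quad \mathit{Null}(S(x))\to\bot,\quad \mathit{Pred}(0)\to 0,\quad \mathit{Pred}(S(x))\to x,$$ $$0+y\to y,\quad S(x)+y\to S(x+y),\quad 0\times y\to 0,\quad S(x)\times y\to x\times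 y+y.$$ \textbf{Proposition.} Let $\equiv_{HA}$ be the congruence defined by $HA$, for predicative or for impredicative arithmetic. Then every proof-term $\pi$ that is a proof of some sequent $\Gamma\vdash A$ in natural deduction modulo $\equiv_{HA}$ is strongly normalizing. -/

import Mathlib

/-! Deduction modulo in many-sorted intuitionistic first-order logic, with proof-terms, and
arithmetic with classes as a theory modulo.

Bound variables are represented by de Bruijn indices, counted separately for every sort:
`var s n` is the variable number `n` of sort `s`, there are infinitely many variables of each sort,
and a binder of sort `s` affects only the numbering of the variables of sort `s`. -/

namespace DeductionModulo

section Logic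

variable {S : Type} [DecidableEq S]

/-- Terms of a many-sorted language with set of sorts `S`; `F n ss s` is the set of function symbols
of rank `⟨ss 0, …, ss (n-1), s⟩`. -/
inductive Term (F : (n : ℕ) → (Fin n → S) → S → Type) : S → Type
  | var (s : S) (n : ℕ) : Term F s
  | app {n : ℕ} {ss : Fin n → S} {s : S} (f : F n ss s) (ts : (i : Fin n) → Term F (ss i)) :
      Term F s

/-- Propositions; `R n ss` is the set of predicate symbols of rank `⟨ss 0, …, ss (n-1)⟩`.
In `all s A` and `ex s A` the variable number `0` of sort `s` is bound in `A`. -/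
inductive Formula (F : (n : ℕ) → (Fin n → S) → S → Type) (R : (n : ℕ) → (Fin n → S) → Type) : Type
  | rel {n : ℕ} {ss : Fin n → S} (P : R n ss) (ts : (i : Fin n) → Term F (ss i)) : Formula F R
  | top : Formula F R
  | bot : Formula F R
  | and (A B : Formula F R) : Formula F R
  | or (A B : Formula F R) : Formula F R
  | imp (A B : Formula F R) : Formula F R
  | all (s : S) (A : Formula F R) : Formula F R
  | ex (s : S) (A : Formula F R) : Formula F R

variable {F G : (n : ℕ) → (Fin n → S) → S → Type} {R : (n : ℕ) → (Fin n → S) → Type}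

/-- The renaming that makes the variable number `0` of sort `s` fresh. -/
def shift (s : S) : S → ℕ → ℕ := fun s' n => if s' = s then n + 1 else n

/-- A renaming under a binder of sort `s`. -/
def upRen (s : S) (r : S → ℕ → ℕ) : S → ℕ → ℕ := fun s' n =>
  if s' = s then
    match n with
    | 0 => 0
    | n + 1 => r s' n + 1
  else r s' n

/-- Renaming of the variables of a term. -/
def Term.rename (r : S → ℕ → ℕ) : {s : S} → Term F s → Term F s
  | _, .var s n => .var s (r s n)
  | _, .app f ts => .app f (fun i => (ts i).rename r)

/-- Simultaneous substitutions of terms for variables. -/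
abbrev Subst (F : (n : ℕ) → (Fin n → S) → S → Type) : Type := (s : S) → ℕ → Term F s

/-- A substitution under a binder of sort `s`. -/
def Subst.up (s : S) (σ : Subst F) : Subst F := fun s' n =>
  if s' = s then
    match n with
    | 0 => .var s' 0
    | n + 1 => (σ s' n).rename (shift s)
  else (σ s' n).rename (shift s)

/-- The substitution `(t/x)`, where `x` is the variable number `0` of sort `s` (whose binder has
been removed, so that the other variables of sort `s` are renumbered). -/
def Subst.inst {s : S} (t : Term F s) : Subst F := fun s' n =>
  if h : s' = s then
    match n with
    | 0 => h ▸ t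
    | n + 1 => .var s' n
  else .var s' n

/-- Application of a substitution to a term. -/
def Term.subst (σ : Subst F) : {s : S} → Term F s → Term F s
  | _, .var s n => σ s n
  | _, .app f ts => .app f (fun i => (ts i).subst σ)

/-- Renaming of the free variables of a proposition. -/
def Formula.rename : (S → ℕ → ℕ) → Formula F R → Formula F R
  | r, .rel P ts => .rel P (fun i => (ts i).rename r)
  | _, .top => .top
  | _, .bot => .bot
  | r, .and A B => .and (A.rename r) (B.rename r)
  | r, .or A B => .or (A.rename r) (B.rename r)
  | r, .imp A B => .imp (A.rename r) (B.rename r)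
  | r, .all s A => .all s (A.rename (upRen s r))
  | r, .ex s A => .ex s (A.rename (upRen s r))

/-- Application of a (capture-avoiding) substitution to a proposition. -/
def Formula.subst : Subst F → Formula F R → Formula F R
  | σ, .rel P ts => .rel P (fun i => (ts i).subst σ)
  | _, .top => .top
  | _, .bot => .bot
  | σ, .and A B => .and (A.subst σ) (B.subst σ)
  | σ, .or A B => .or (A.subst σ) (B.subst σ)
  | σ, .imp A B => .imp (A.subst σ) (B.subst σ)
  | σ, .all s A => .all s (A.subst (σ.up s))
  | σ, .ex s A => .ex s (A.subst (σ.up s))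

/-- The variables of a term. -/
def Term.FV : {s : S} → Term F s → Set (S × ℕ)
  | _, .var s n => {(s, n)}
  | _, .app _ ts => ⋃ i, (ts i).FV

/-- The free variables of a proposition. -/
def Formula.FV : Formula F R → Set (S × ℕ)
  | .rel _ ts => ⋃ i, (ts i).FV
  | .top => ∅
  | .bot => ∅
  | .and A B => A.FV ∪ B.FV
  | .or A B => A.FV ∪ B.FV
  | .imp A B => A.FV ∪ B.FV
  | .all s A => {v | (v.1, shift s v.1 v.2) ∈ A.FV}
  | .ex s A => {v | (v.1, shift s v.1 v.2) ∈ A.FV}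

/-- Translation of terms along a map of function symbols. -/
def Term.mapFn (e : {n : ℕ} → {ss : Fin n → S} → {s : S} → F n ss s → G n ss s) :
    {s : S} → Term F s → Term G s
  | _, .var s n => .var s n
  | _, .app f ts => .app (e f) (fun i => (ts i).mapFn e)

/-- Translation of propositions along a map of function symbols. -/
def Formula.mapFn (e : {n : ℕ} → {ss : Fin n → S} → {s : S} → F n ss s → G n ss s) :
    Formula F R → Formula G R
  | .rel P ts => .rel P (fun i => (ts i).mapFn e)
  | .top => .top
  | .bot => .bot
  | .and A B => .and (A.mapFn e) (B.mapFn e)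
  | .or A B => .or (A.mapFn e) (B.mapFn e)
  | .imp A B => .imp (A.mapFn e) (B.mapFn e)
  | .all s A => .all s (A.mapFn e)
  | .ex s A => .ex s (A.mapFn e)

/-- A rewrite system: a set of rules rewriting terms to terms and of rules rewriting propositions to
propositions. -/
structure RewriteSystem (F : (n : ℕ) → (Fin n → S) → S → Type)
    (R : (n : ℕ) → (Fin n → S) → Type) where
  termRule : {s : S} → Term F s → Term F s → Prop
  propRule : Formula F R → Formula F R → Prop

/-- The congruence defined by a rewrite system, on terms. -/
inductive RewriteSystem.TermCongr (E : RewriteSystem F R) : {s : S} → Term F s → Term F s → Prop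
  | rule {s : S} {l r : Term F s} (h : E.termRule l r) (σ : Subst F) :
      TermCongr E (l.subst σ) (r.subst σ)
  | refl {s : S} (t : Term F s) : TermCongr E t t
  | symm {s : S} {t u : Term F s} : TermCongr E t u → TermCongr E u t
  | trans {s : S} {t u v : Term F s} : TermCongr E t u → TermCongr E u v → TermCongr E t v
  | app {n : ℕ} {ss : Fin n → S} {s : S} (f : F n ss s) {ts us : (i : Fin n) → Term F (ss i)} :
      (∀ i, TermCongr E (ts i) (us i)) → TermCongr E (.app f ts) (.app f us)

/-- The congruence defined by a rewrite system, on propositions. -/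
inductive RewriteSystem.Congr (E : RewriteSystem F R) : Formula F R → Formula F R → Prop
  | rule {l r : Formula F R} (h : E.propRule l r) (σ : Subst F) : Congr E (l.subst σ) (r.subst σ)
  | refl (A : Formula F R) : Congr E A A
  | symm {A B : Formula F R} : Congr E A B → Congr E B A
  | trans {A B C : Formula F R} : Congr E A B → Congr E B C → Congr E A C
  | rel {n : ℕ} {ss : Fin n → S} (P : R n ss) {ts us : (i : Fin n) → Term F (ss i)} :
      (∀ i, E.TermCongr (ts i) (us i)) → Congr E (.rel P ts) (.rel P us)
  | and {A A' B B' : Formula F R} : Congr E A A' → Congr E B B' → Congr E (.and A B) (.and A' B')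
  | or {A A' B B' : Formula F R} : Congr E A A' → Congr E B B' → Congr E (.or A B) (.or A' B')
  | imp {A A' B B' : Formula F R} : Congr E A A' → Congr E B B' → Congr E (.imp A B) (.imp A' B')
  | all (s : S) {A A' : Formula F R} : Congr E A A' → Congr E (.all s A) (.all s A')
  | ex (s : S) {A A' : Formula F R} : Congr E A A' → Congr E (.ex s A) (.ex s A')

/-- Proof-terms. Proof variables are de Bruijn indices as well: `lam π` binds the proof variable `0`
of `π`, `cases π₁ π₂ π₃` (the term `δ(π₁, α π₂, β π₃)`) binds it in `π₂` and in `π₃`, `tlam s π`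
binds the variable `0` of sort `s` in `π`, and `unpack s π₁ π₂` (the term `δ_∃(π₁, x α π₂)`) binds
in `π₂` both the variable `0` of sort `s` and the proof variable `0`. -/
inductive ProofTerm (F : (n : ℕ) → (Fin n → S) → S → Type) : Type
  | hyp (n : ℕ) : ProofTerm F
  | triv : ProofTerm F
  | botElim (π : ProofTerm F) : ProofTerm F
  | pair (π₁ π₂ : ProofTerm F) : ProofTerm F
  | fst (π : ProofTerm F) : ProofTerm F
  | snd (π : ProofTerm F) : ProofTerm F
  | inl (π : ProofTerm F) : ProofTerm F
  | inr (π : ProofTerm F) : ProofTerm F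
  | cases (π₁ π₂ π₃ : ProofTerm F) : ProofTerm F
  | lam (π : ProofTerm F) : ProofTerm F
  | app (π₁ π₂ : ProofTerm F) : ProofTerm F
  | tlam (s : S) (π : ProofTerm F) : ProofTerm F
  | tapp {s : S} (π : ProofTerm F) (t : Term F s) : ProofTerm F
  | tpair {s : S} (t : Term F s) (π : ProofTerm F) : ProofTerm F
  | unpack (s : S) (π₁ π₂ : ProofTerm F) : ProofTerm F

namespace ProofTerm

/-- A renaming of proof variables under a binder of a proof variable. -/
def upIdx (k : ℕ → ℕ) : ℕ → ℕ
  | 0 => 0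
  | n + 1 => k n + 1

/-- Renaming of the term variables (by `r`) and of the proof variables (by `k`). -/
def rename : (S → ℕ → ℕ) → (ℕ → ℕ) → ProofTerm F → ProofTerm F
  | _, k, hyp n => hyp (k n)
  | _, _, triv => triv
  | r, k, botElim π => botElim (π.rename r k)
  | r, k, pair π₁ π₂ => pair (π₁.rename r k) (π₂.rename r k)
  | r, k, fst π => fst (π.rename r k)
  | r, k, snd π => snd (π.rename r k)
  | r, k, inl π => inl (π.rename r k)
  | r, k, inr π => inr (π.rename r k)
  | r, k, cases π₁ π₂ π₃ =>
      cases (π₁.rename r k) (π₂.rename r (upIdx k)) (π₃.rename r (upIdx k))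
  | r, k, lam π => lam (π.rename r (upIdx k))
  | r, k, app π₁ π₂ => app (π₁.rename r k) (π₂.rename r k)
  | r, k, tlam s π => tlam s (π.rename (upRen s r) k)
  | r, k, tapp π t => tapp (π.rename r k) (t.rename r)
  | r, k, tpair t π => tpair (t.rename r) (π.rename r k)
  | r, k, unpack s π₁ π₂ => unpack s (π₁.rename r k) (π₂.rename (upRen s r) (upIdx k))

/-- A substitution of proof-terms for proof variables, under a binder of a proof variable. -/
def upHyp (θ : ℕ → ProofTerm F) : ℕ → ProofTerm F
  | 0 => hyp 0
  | n + 1 => (θ n).rename (fun _ m => m) (fun m => m + 1)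

/-- A substitution of proof-terms for proof variables, under a binder of a term variable. -/
def upVar (s : S) (θ : ℕ → ProofTerm F) : ℕ → ProofTerm F :=
  fun n => (θ n).rename (shift s) (fun m => m)

/-- Simultaneous substitution of terms for term variables and of proof-terms for proof variables. -/
def subst : Subst F → (ℕ → ProofTerm F) → ProofTerm F → ProofTerm F
  | _, θ, hyp n => θ n
  | _, _, triv => triv
  | σ, θ, botElim π => botElim (π.subst σ θ)
  | σ, θ, pair π₁ π₂ => pair (π₁.subst σ θ) (π₂.subst σ θ)
  | σ, θ, fst π => fst (π.subst σ θ)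
  | σ, θ, snd π => snd (π.subst σ θ)
  | σ, θ, inl π => inl (π.subst σ θ)
  | σ, θ, inr π => inr (π.subst σ θ)
  | σ, θ, cases π₁ π₂ π₃ => cases (π₁.subst σ θ) (π₂.subst σ (upHyp θ)) (π₃.subst σ (upHyp θ))
  | σ, θ, lam π => lam (π.subst σ (upHyp θ))
  | σ, θ, app π₁ π₂ => app (π₁.subst σ θ) (π₂.subst σ θ)
  | σ, θ, tlam s π => tlam s (π.subst (σ.up s) (upVar s θ))
  | σ, θ, tapp π t => tapp (π.subst σ θ) (t.subst σ)
  | σ, θ, tpair t π => tpair (t.subst σ) (π.subst σ θ)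
  | σ, θ, unpack s π₁ π₂ => unpack s (π₁.subst σ θ) (π₂.subst (σ.up s) (upHyp (upVar s θ)))

/-- The substitution `(ρ/α)` where `α` is the proof variable `0`, whose binder has been removed. -/
def instHyp (ρ : ProofTerm F) : ℕ → ProofTerm F
  | 0 => ρ
  | n + 1 => hyp n

/-- One-step reduction: the seven cut-elimination rules, applied anywhere in a proof-term. -/
inductive Step : ProofTerm F → ProofTerm F → Prop
  | fst_pair (π₁ π₂) : Step (fst (pair π₁ π₂)) π₁
  | snd_pair (π₁ π₂) : Step (snd (pair π₁ π₂)) π₂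
  | cases_inl (π₁ π₂ π₃) : Step (cases (inl π₁) π₂ π₃) (π₂.subst Term.var (instHyp π₁))
  | cases_inr (π₁ π₂ π₃) : Step (cases (inr π₁) π₂ π₃) (π₃.subst Term.var (instHyp π₁))
  | app_lam (π₁ π₂) : Step (app (lam π₁) π₂) (π₁.subst Term.var (instHyp π₂))
  | tapp_tlam {s : S} (π) (t : Term F s) : Step (tapp (tlam s π) t) (π.subst (Subst.inst t) hyp)
  | unpack_tpair {s : S} (t : Term F s) (π₁ π₂) :
      Step (unpack s (tpair t π₁) π₂) (π₂.subst (Subst.inst t) (instHyp π₁))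
  | botElim {π π'} : Step π π' → Step (botElim π) (botElim π')
  | pair_left {π₁ π₁'} (π₂) : Step π₁ π₁' → Step (pair π₁ π₂) (pair π₁' π₂)
  | pair_right (π₁) {π₂ π₂'} : Step π₂ π₂' → Step (pair π₁ π₂) (pair π₁ π₂')
  | fst {π π'} : Step π π' → Step (fst π) (fst π')
  | snd {π π'} : Step π π' → Step (snd π) (snd π')
  | inl {π π'} : Step π π' → Step (inl π) (inl π')
  | inr {π π'} : Step π π' → Step (inr π) (inr π')
  | cases_arg {π₁ π₁'} (π₂ π₃) : Step π₁ π₁' → Step (cases π₁ π₂ π₃) (cases π₁' π₂ π₃)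
  | cases_left (π₁) {π₂ π₂'} (π₃) : Step π₂ π₂' → Step (cases π₁ π₂ π₃) (cases π₁ π₂' π₃)
  | cases_right (π₁ π₂) {π₃ π₃'} : Step π₃ π₃' → Step (cases π₁ π₂ π₃) (cases π₁ π₂ π₃')
  | lam {π π'} : Step π π' → Step (lam π) (lam π')
  | app_left {π₁ π₁'} (π₂) : Step π₁ π₁' → Step (app π₁ π₂) (app π₁' π₂)
  | app_right (π₁) {π₂ π₂'} : Step π₂ π₂' → Step (app π₁ π₂) (app π₁ π₂')
  | tlam (s : S) {π π'} : Step π π' → Step (tlam s π) (tlam s π')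
  | tapp {s : S} {π π'} (t : Term F s) : Step π π' → Step (tapp π t) (tapp π' t)
  | tpair {s : S} (t : Term F s) {π π'} : Step π π' → Step (tpair t π) (tpair t π')
  | unpack_arg (s : S) {π₁ π₁'} (π₂) : Step π₁ π₁' → Step (unpack s π₁ π₂) (unpack s π₁' π₂)
  | unpack_body (s : S) (π₁) {π₂ π₂'} : Step π₂ π₂' → Step (unpack s π₁ π₂) (unpack s π₁ π₂')

/-- A proof-term is strongly normalizing if its reduction tree is finite: it has finitely many
one-step reducts, and the reduction tree of each of them is finite. -/
inductive SN : ProofTerm F → Prop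
  | intro (π : ProofTerm F) (hfin : {π' | Step π π'}.Finite) (h : ∀ π', Step π π' → SN π') : SN π

end ProofTerm

open ProofTerm in
/-- Intuitionistic natural deduction modulo the congruence defined by `E`: `E.Proves Γ π A` means
that the proof-term `π` is a proof of the sequent `Γ ⊢ A`, where the proof variable `n` stands for
the hypothesis number `n` of `Γ`. The condition that the variable of `∀`-introduction and of
`∃`-elimination is not free in `Γ` (and `B`) is expressed by shifting `Γ` (and `B`). -/
inductive RewriteSystem.Proves (E : RewriteSystem F R) :
    List (Formula F R) → ProofTerm F → Formula F R → Prop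
  | ax {Γ} {n : ℕ} {A B} : Γ[n]? = some A → E.Congr A B → Proves E Γ (hyp n) B
  | topIntro {Γ A} : E.Congr A .top → Proves E Γ triv A
  | botElim {Γ π A B} : E.Congr B .bot → Proves E Γ π B → Proves E Γ (botElim π) A
  | andIntro {Γ π₁ π₂ A B C} : E.Congr C (.and A B) → Proves E Γ π₁ A → Proves E Γ π₂ B →
      Proves E Γ (pair π₁ π₂) C
  | andLeft {Γ π A B C} : E.Congr C (.and A B) → Proves E Γ π C → Proves E Γ (fst π) A
  | andRight {Γ π A B C} : E.Congr C (.and A B) → Proves E Γ π C → Proves E Γ (snd π) B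
  | orLeft {Γ π A B C} : E.Congr C (.or A B) → Proves E Γ π A → Proves E Γ (inl π) C
  | orRight {Γ π A B C} : E.Congr C (.or A B) → Proves E Γ π B → Proves E Γ (inr π) C
  | orElim {Γ π₁ π₂ π₃ A B C D} : E.Congr D (.or A B) → Proves E Γ π₁ D →
      Proves E (A :: Γ) π₂ C → Proves E (B :: Γ) π₃ C → Proves E Γ (cases π₁ π₂ π₃) C
  | impIntro {Γ π A B C} : E.Congr C (.imp A B) → Proves E (A :: Γ) π B → Proves E Γ (lam π) C
  | impElim {Γ π₁ π₂ A B C} : E.Congr C (.imp A B) → Proves E Γ π₁ C → Proves E Γ π₂ A →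
      Proves E Γ (app π₁ π₂) B
  | allIntro {Γ π A B} {s : S} : E.Congr B (.all s A) →
      Proves E (Γ.map (Formula.rename (shift s))) π A → Proves E Γ (tlam s π) B
  | allElim {Γ π A B C} {s : S} (t : Term F s) : E.Congr B (.all s A) →
      E.Congr C (A.subst (Subst.inst t)) → Proves E Γ π B → Proves E Γ (tapp π t) C
  | exIntro {Γ π A B C} {s : S} (t : Term F s) : E.Congr B (.ex s A) →
      E.Congr C (A.subst (Subst.inst t)) → Proves E Γ π C → Proves E Γ (tpair t π) B
  | exElim {Γ π₁ π₂ A B C} {s : S} : E.Congr C (.ex s A) → Proves E Γ π₁ C →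
      Proves E (A :: Γ.map (Formula.rename (shift s))) π₂ (B.rename (shift s)) →
      Proves E Γ (unpack s π₁ π₂) B

end Logic

section Arithmetic

/-- The sorts: `ι` (natural numbers) and `κ` (classes of natural numbers). -/
inductive Srt : Type
  | ι
  | κ
  deriving DecidableEq

open Srt

/-- The function symbols of arithmetic other than the comprehension symbols. -/
inductive BaseFn : (n : ℕ) → (Fin n → Srt) → Srt → Type
  | zero : BaseFn 0 ![] ι
  | succ : BaseFn 1 ![ι] ι
  | pred : BaseFn 1 ![ι] ι
  | add : BaseFn 2 ![ι, ι] ι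
  | mul : BaseFn 2 ![ι, ι] ι

/-- The predicate symbols `=`, `N`, `Null` and `ε` of arithmetic. -/
inductive ArithRel : (n : ℕ) → (Fin n → Srt) → Type
  | eq : ArithRel 2 ![ι, ι]
  | nat : ArithRel 1 ![ι]
  | null : ArithRel 1 ![ι]
  | mem : ArithRel 2 ![ι, κ]

/-- The data `x, y₁, …, yₙ, A` of an instance of the comprehension scheme: a variable `x` of sort
`ι`, variables `yᵢ` of arbitrary sorts, all distinct, and a proposition `A` of the language without
comprehension symbols, whose free variables are among `x, y₁, …, yₙ`. -/
structure Abstraction where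
  x : ℕ
  n : ℕ
  y : Fin n → Srt × ℕ
  A : Formula BaseFn ArithRel
  y_injective : Function.Injective y
  y_ne_x : ∀ i, y i ≠ (ι, x)
  fv_subset : A.FV ⊆ insert (ι, x) (Set.range y)

/-- The propositions that contain neither `ε` nor quantifiers over classes. -/
def IsArithmetical : Formula BaseFn ArithRel → Prop
  | .rel .eq _ => True
  | .rel .nat _ => True
  | .rel .null _ => True
  | .rel .mem _ => False
  | .top => True
  | .bot => True
  | .and A B => IsArithmetical A ∧ IsArithmetical B
  | .or A B => IsArithmetical A ∧ IsArithmetical B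
  | .imp A B => IsArithmetical A ∧ IsArithmetical B
  | .all s A => s = ι ∧ IsArithmetical A
  | .ex s A => s = ι ∧ IsArithmetical A

/-- The comprehension scheme of predicative arithmetic: only propositions of the language without
the sort `κ` and the symbol `ε`. -/
def predicative : Set Abstraction := {c | IsArithmetical c.A ∧ ∀ i, (c.y i).1 = ι}

/-- The comprehension scheme of impredicative arithmetic: all propositions. -/
def impredicative : Set Abstraction := Set.univ

/-- The function symbols of arithmetic with the comprehension scheme `𝒞`: those of the base language
and a symbol `f_{x, y₁, …, yₙ, A}` for each instance of the scheme. -/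
inductive ArithFn (𝒞 : Set Abstraction) : (n : ℕ) → (Fin n → Srt) → Srt → Type
  | base {n : ℕ} {ss : Fin n → Srt} {s : Srt} (f : BaseFn n ss s) : ArithFn 𝒞 n ss s
  | skolem (c : Abstraction) (hc : c ∈ 𝒞) : ArithFn 𝒞 c.n (fun i => (c.y i).1) κ

variable {𝒞 : Set Abstraction}

/-- Terms of arithmetic with the comprehension scheme `𝒞`. -/
abbrev ATerm (𝒞 : Set Abstraction) : Srt → Type := Term (ArithFn 𝒞)

/-- Propositions of arithmetic with the comprehension scheme `𝒞`. -/
abbrev AFormula (𝒞 : Set Abstraction) : Type := Formula (ArithFn 𝒞) ArithRel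

/-- The term `0`. -/
def zero : ATerm 𝒞 ι := .app (.base .zero) (fun i => i.elim0)

/-- The term `S(t)`. -/
def succ (t : ATerm 𝒞 ι) : ATerm 𝒞 ι := .app (.base .succ) (fun | 0 => t)

/-- The term `Pred(t)`. -/
def pred (t : ATerm 𝒞 ι) : ATerm 𝒞 ι := .app (.base .pred) (fun | 0 => t)

/-- The term `t + u`. -/
def add (t u : ATerm 𝒞 ι) : ATerm 𝒞 ι := .app (.base .add) (fun | 0 => t | 1 => u)

/-- The term `t × u`. -/
def mul (t u : ATerm 𝒞 ι) : ATerm 𝒞 ι := .app (.base .mul) (fun | 0 => t | 1 => u)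

/-- The proposition `t = u`. -/
def eq (t u : ATerm 𝒞 ι) : AFormula 𝒞 := .rel .eq (fun | 0 => t | 1 => u)

/-- The proposition `N(t)`. -/
def nat (t : ATerm 𝒞 ι) : AFormula 𝒞 := .rel .nat (fun | 0 => t)

/-- The proposition `Null(t)`. -/
def null (t : ATerm 𝒞 ι) : AFormula 𝒞 := .rel .null (fun | 0 => t)

/-- The proposition `t ε u`. -/
def mem (t : ATerm 𝒞 ι) (u : ATerm 𝒞 κ) : AFormula 𝒞 := .rel .mem (fun | 0 => t | 1 => u)

/-- The variable number `n` of sort `ι`. -/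
def vι (n : ℕ) : ATerm 𝒞 ι := .var ι n

/-- The variable number `n` of sort `κ`. -/
def vκ (n : ℕ) : ATerm 𝒞 κ := .var κ n

/-- The rules of `HA` that rewrite terms to terms. -/
inductive HATermRule (𝒞 : Set Abstraction) : {s : Srt} → ATerm 𝒞 s → ATerm 𝒞 s → Prop
  | pred_zero : HATermRule 𝒞 (pred zero) zero
  | pred_succ : HATermRule 𝒞 (pred (succ (vι 0))) (vι 0)
  | zero_add : HATermRule 𝒞 (add zero (vι 1)) (vι 1)
  | succ_add : HATermRule 𝒞 (add (succ (vι 0)) (vι 1)) (succ (add (vι 0) (vι 1)))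
  | zero_mul : HATermRule 𝒞 (mul zero (vι 1)) zero
  | succ_mul : HATermRule 𝒞 (mul (succ (vι 0)) (vι 1)) (add (mul (vι 0) (vι 1)) (vι 1))

/-- The rules of `HA` that rewrite atomic propositions to propositions:
`x ε f_{x, y₁, …, yₙ, A}(y₁, …, yₙ) ⟶ A`, `y = z ⟶ ∀ X (y ε X ⇒ z ε X)`,
`N(n) ⟶ ∀ X (0 ε X ⇒ ∀ y (N(y) ⇒ y ε X ⇒ S(y) ε X) ⇒ n ε X)`, `Null(0) ⟶ ⊤`, `Null(S(x)) ⟶ ⊥`.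
A binder of sort `κ` does not renumber the variables of sort `ι`; in the rule for `N`, `y` is the
occurrence of `vι 0` under the quantifier of sort `ι`, and `n` is the one outside. -/
inductive HAPropRule (𝒞 : Set Abstraction) : AFormula 𝒞 → AFormula 𝒞 → Prop
  | comprehension (c : Abstraction) (hc : c ∈ 𝒞) :
      HAPropRule 𝒞
        (mem (vι c.x) (.app (.skolem c hc) (fun i => .var (c.y i).1 (c.y i).2)))
        (c.A.mapFn .base)
  | eq :
      HAPropRule 𝒞 (eq (vι 0) (vι 1))
        (.all κ (.imp (mem (vι 0) (vκ 0)) (mem (vι 1) (vκ 0))))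
  | nat :
      HAPropRule 𝒞 (nat (vι 0))
        (.all κ (.imp (mem zero (vκ 0))
          (.imp
            (.all ι (.imp (nat (vι 0)) (.imp (mem (vι 0) (vκ 0)) (mem (succ (vι 0)) (vκ 0)))))
            (mem (vι 0) (vκ 0)))))
  | null_zero : HAPropRule 𝒞 (null zero) .top
  | null_succ : HAPropRule 𝒞 (null (succ (vι 0))) .bot

/-- The rewrite system `HA` with the comprehension scheme `𝒞`. -/
def HA (𝒞 : Set Abstraction) : RewriteSystem (ArithFn 𝒞) ArithRel where
  termRule := HATermRule 𝒞
  propRule := HAPropRule 𝒞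

end Arithmetic

end DeductionModulo

namespace DeductionModulo

/-! ### Substitution calculus for terms and proof-terms -/

section Logic

variable {S : Type}
variable {F G : (n : ℕ) → (Fin n → S) → S → Type} {R : (n : ℕ) → (Fin n → S) → Type}

/-! The proof is Tait–Girard reducibility, organised as a model whose truth values generate
reducibility candidates. A truth value is an arbitrary set `V` of proof-terms, without closure
conditions. The candidate `Realizes V` consists of the terms with well-founded reduction such that
every reduct (the term itself included) that ends with an introduction lies in `V`. Every candidate
contains the proof variables and only strongly normalizing terms, and each connective has an
operation on truth values for which the introduction and elimination rules are sound.

Reducibility cannot be defined by recursion on propositions, since a congruence may identify an atom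
with a proposition that mentions it again. Hence propositions are interpreted in a model
(`Model.interp`). If both sides of each rewrite rule have equal values, congruent propositions have
equal values (`Model.Validates.congr`), every proof realizes its conclusion
(`Model.Validates.realizes`), and every proof strongly normalizes (`Model.Validates.sn`).

It remains to build such a model of `HA`. Numbers range over `ℕ`, classes over all functions from
`ℕ` to truth values. This class domain is fixed in advance, so even impredicative comprehension only
names one of its elements. Equality is interpreted by the right-hand side of its rule. `N` recurs in
its own rule, but positively, so it is a least fixed point (Knaster–Tarski). `Null` is constant,
because `⊤` and `⊥` receive the same truth value. -/

theorem Term.rename_rename (r r' : S → ℕ → ℕ) {s : S} (t : Term F s) :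
    (t.rename r).rename r' = t.rename (fun s n => r' s (r s n)) := by
  induction t with
  | var s n => rfl
  | app f ts ih => simp only [Term.rename, ih]

theorem Term.rename_subst (r : S → ℕ → ℕ) (σ : Subst F) {s : S} (t : Term F s) :
    (t.rename r).subst σ = t.subst (fun s n => σ s (r s n)) := by
  induction t with
  | var s n => rfl
  | app f ts ih => simp only [Term.rename, Term.subst, ih]

theorem Term.subst_rename (σ : Subst F) (r : S → ℕ → ℕ) {s : S} (t : Term F s) :
    (t.subst σ).rename r = t.subst (fun s n => (σ s n).rename r) := by
  induction t with
  | var s n => rfl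
  | app f ts ih => simp only [Term.rename, Term.subst, ih]

theorem Term.subst_subst (σ τ : Subst F) {s : S} (t : Term F s) :
    (t.subst σ).subst τ = t.subst (fun s n => (σ s n).subst τ) := by
  induction t with
  | var s n => rfl
  | app f ts ih => simp only [Term.subst, ih]

theorem Term.subst_var {s : S} (t : Term F s) : t.subst Term.var = t := by
  induction t with
  | var s n => rfl
  | app f ts ih => simp only [Term.subst, ih]

theorem Term.rename_id {s : S} (t : Term F s) : t.rename (fun _ n => n) = t := by
  induction t with
  | var s n => rfl
  | app f ts ih => simp only [Term.rename, ih]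

variable [DecidableEq S]

theorem upRen_comp (s : S) (r r' : S → ℕ → ℕ) :
    (fun s' n => upRen s r' s' (upRen s r s' n)) = upRen s (fun s' n => r' s' (r s' n)) := by
  funext s' n
  by_cases h : s' = s <;> cases n <;> simp [upRen, h]

theorem upRen_shift (s : S) (r : S → ℕ → ℕ) :
    (fun s' n => upRen s r s' (shift s s' n)) = fun s' n => shift s s' (r s' n) := by
  funext s' n
  by_cases h : s' = s <;> simp [upRen, shift, h]

theorem Subst.up_upRen (s : S) (r : S → ℕ → ℕ) (σ : Subst F) :
    (fun s' n => σ.up s s' (upRen s r s' n)) = Subst.up s (fun s' n => σ s' (r s' n)) := by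
  funext s' n
  by_cases h : s' = s <;> cases n <;> simp [upRen, Subst.up, h]

theorem Subst.up_shift (s : S) (σ : Subst F) :
    (fun s' n => σ.up s s' (shift s s' n)) = fun s' n => (σ s' n).rename (shift s) := by
  funext s' n
  by_cases h : s' = s <;> simp [shift, Subst.up, h]

theorem Subst.up_rename (s : S) (r : S → ℕ → ℕ) (σ : Subst F) :
    (fun s' n => (σ.up s s' n).rename (upRen s r)) =
      Subst.up s (fun s' n => (σ s' n).rename r) := by
  funext s' n
  by_cases h : s' = s <;> cases n <;>
    simp only [Subst.up, h, if_true, if_false, Term.rename, Term.rename_rename, upRen_shift]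
  simp [upRen]

theorem Subst.up_subst (s : S) (σ τ : Subst F) :
    (fun s' n => (σ.up s s' n).subst (τ.up s)) = Subst.up s (fun s' n => (σ s' n).subst τ) := by
  funext s' n
  by_cases h : s' = s <;> cases n <;>
    simp only [Subst.up.eq_def s σ, Subst.up.eq_def s (fun s' n => (σ s' n).subst τ), h, if_true,
      if_false, Term.subst, Term.rename_subst, Subst.up_shift, Term.subst_rename]
  simp [Subst.up, h]

theorem Subst.up_var (s : S) : Subst.up s (Term.var : Subst F) = Term.var := by
  funext s' n
  by_cases h : s' = s <;> cases n <;> simp [Subst.up, h, Term.rename, shift]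

theorem Subst.inst_shift {s : S} (t : Term F s) :
    (fun s' n => Subst.inst t s' (shift s s' n)) = Term.var := by
  funext s' n
  by_cases h : s' = s
  · subst h; simp [Subst.inst, shift]
  · simp [Subst.inst, shift, h]

/-- The substitution that extends `σ` by `t` for the variable number `0` of sort `s`. -/
def Subst.cons {s : S} (t : Term F s) (σ : Subst F) : Subst F := fun s' n =>
  if h : s' = s then
    match n with
    | 0 => h ▸ t
    | n + 1 => σ s' n
  else σ s' n

theorem Subst.up_inst {s : S} (t : Term F s) (σ : Subst F) :
    (fun s' n => (σ.up s s' n).subst (Subst.inst t)) = Subst.cons t σ := by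
  funext s' n
  by_cases h : s' = s
  · subst h
    cases n <;> simp [Subst.up, Subst.cons, Term.rename_subst, Term.subst, Subst.inst_shift,
      Term.subst_var]
    simp [Subst.inst]
  · simp [Subst.up, Subst.cons, h, Term.rename_subst, Subst.inst_shift, Term.subst_var]

theorem Subst.inst_subst {s : S} (t : Term F s) (σ : Subst F) :
    (fun s' n => (Subst.inst t s' n).subst σ) = Subst.cons (t.subst σ) σ := by
  funext s' n
  by_cases h : s' = s
  · subst h
    cases n <;> simp [Subst.inst, Subst.cons, Term.subst]
  · simp [Subst.inst, Subst.cons, h, Term.subst]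

namespace ProofTerm

theorem upIdx_comp (k k' : ℕ → ℕ) :
    (fun n => upIdx k' (upIdx k n)) = upIdx (fun n => k' (k n)) := by
  funext n; cases n <;> rfl

theorem rename_rename (r r' : S → ℕ → ℕ) (k k' : ℕ → ℕ) (π : ProofTerm F) :
    (π.rename r k).rename r' k' = π.rename (fun s n => r' s (r s n)) (fun n => k' (k n)) := by
  induction π generalizing r r' k k' <;>
    simp_all only [rename, Term.rename_rename, upIdx_comp, upRen_comp]

theorem upHyp_upIdx (k : ℕ → ℕ) (θ : ℕ → ProofTerm F) :
    (fun n => upHyp θ (upIdx k n)) = upHyp (fun n => θ (k n)) := by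
  funext n; cases n <;> rfl

theorem rename_subst (r : S → ℕ → ℕ) (k : ℕ → ℕ) (σ : Subst F) (θ : ℕ → ProofTerm F)
    (π : ProofTerm F) :
    (π.rename r k).subst σ θ = π.subst (fun s n => σ s (r s n)) (fun n => θ (k n)) := by
  induction π generalizing r k σ θ <;>
    simp_all only [rename, subst, Term.rename_subst, upHyp_upIdx, Subst.up_upRen] <;> rfl

theorem upHyp_rename (r : S → ℕ → ℕ) (k : ℕ → ℕ) (θ : ℕ → ProofTerm F) :
    (fun n => (upHyp θ n).rename r (upIdx k)) = upHyp (fun n => (θ n).rename r k) := by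
  funext n; cases n <;> simp [upHyp, rename, upIdx, rename_rename]

theorem upVar_rename (s : S) (r : S → ℕ → ℕ) (k : ℕ → ℕ) (θ : ℕ → ProofTerm F) :
    (fun n => (upVar s θ n).rename (upRen s r) k) = upVar s (fun n => (θ n).rename r k) := by
  funext n; simp [upVar, rename_rename, upRen_shift]

theorem subst_rename (σ : Subst F) (θ : ℕ → ProofTerm F) (r : S → ℕ → ℕ) (k : ℕ → ℕ)
    (π : ProofTerm F) :
    (π.subst σ θ).rename r k =
      π.subst (fun s n => (σ s n).rename r) (fun n => (θ n).rename r k) := by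
  induction π generalizing r k σ θ <;>
    simp_all only [rename, subst, Term.subst_rename, upHyp_rename, upVar_rename, Subst.up_rename]

theorem upHyp_subst (σ : Subst F) (θ θ' : ℕ → ProofTerm F) :
    (fun n => (upHyp θ n).subst σ (upHyp θ')) = upHyp (fun n => (θ n).subst σ θ') := by
  funext n; cases n <;> simp [upHyp, subst, rename_subst, subst_rename, Term.rename_id]

theorem upVar_subst (s : S) (σ : Subst F) (θ θ' : ℕ → ProofTerm F) :
    (fun n => (upVar s θ n).subst (σ.up s) (upVar s θ')) =
      upVar s (fun n => (θ n).subst σ θ') := by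
  funext n
  simp only [upVar, rename_subst, Subst.up_shift, subst_rename]

theorem subst_subst (σ τ : Subst F) (θ θ' : ℕ → ProofTerm F) (π : ProofTerm F) :
    (π.subst σ θ).subst τ θ' =
      π.subst (fun s n => (σ s n).subst τ) (fun n => (θ n).subst τ θ') := by
  induction π generalizing σ τ θ θ' <;>
    simp_all only [subst, Term.subst_subst, upHyp_subst, upVar_subst, Subst.up_subst]

theorem upHyp_hyp : upHyp (hyp : ℕ → ProofTerm F) = hyp := by
  funext n; cases n <;> rfl

theorem upVar_hyp (s : S) : upVar s (hyp : ℕ → ProofTerm F) = hyp := rfl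

theorem subst_var_hyp (π : ProofTerm F) : π.subst Term.var hyp = π := by
  induction π <;> simp_all only [subst, Term.subst_var, upHyp_hyp, upVar_hyp, Subst.up_var]

/-- The substitution that extends `θ` by `ρ` for the proof variable number `0`. -/
def consHyp (ρ : ProofTerm F) (θ : ℕ → ProofTerm F) : ℕ → ProofTerm F
  | 0 => ρ
  | n + 1 => θ n

theorem instHyp_subst (ρ : ProofTerm F) (σ : Subst F) (θ : ℕ → ProofTerm F) :
    (fun n => (instHyp ρ n).subst σ θ) = consHyp (ρ.subst σ θ) θ := by
  funext n; cases n <;> rfl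

theorem upHyp_instHyp (ρ : ProofTerm F) (σ : Subst F) (θ : ℕ → ProofTerm F) :
    (fun n => (upHyp θ n).subst σ (instHyp ρ)) = consHyp ρ (fun n => (θ n).subst σ hyp) := by
  funext n; cases n <;> simp [upHyp, subst, instHyp, consHyp, rename_subst]

theorem upVar_inst {s : S} (t : Term F s) (θ : ℕ → ProofTerm F) :
    (fun n => (upVar s θ n).subst (Subst.inst t) hyp) = θ := by
  funext n
  simp only [upVar, rename_subst, Subst.inst_shift]
  exact subst_var_hyp _

/-- Substituting under a binder and then contracting is a single simultaneous substitution. This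
matches the body of a reduct with the extended substitution of the induction hypothesis in the
soundness proof. The two lemmas that follow do the same for the other binders. -/
theorem subst_upHyp_instHyp (σ : Subst F) (θ : ℕ → ProofTerm F) (ρ π : ProofTerm F) :
    (π.subst σ (upHyp θ)).subst Term.var (instHyp ρ) = π.subst σ (consHyp ρ θ) := by
  simp only [subst_subst, upHyp_instHyp, Term.subst_var, subst_var_hyp]

theorem subst_up_inst {s : S} (σ : Subst F) (θ : ℕ → ProofTerm F) (t : Term F s)
    (π : ProofTerm F) :
    (π.subst (σ.up s) (upVar s θ)).subst (Subst.inst t) hyp = π.subst (Subst.cons t σ) θ := by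
  simp only [subst_subst, upVar_inst, Subst.up_inst]

theorem subst_up_inst_instHyp {s : S} (σ : Subst F) (θ : ℕ → ProofTerm F) (t : Term F s)
    (ρ π : ProofTerm F) :
    (π.subst (σ.up s) (upHyp (upVar s θ))).subst (Subst.inst t) (instHyp ρ) =
      π.subst (Subst.cons t σ) (consHyp ρ θ) := by
  simp only [subst_subst, upHyp_instHyp, upVar_inst, Subst.up_inst]

/-! ### Reduction: stability under substitution, finite branching, strong normalization -/

/-- For the contractions that substitute, contracting before or after `σ, θ` gives the same
simultaneous substitution, by the fusion laws above. -/
theorem Step.subst {π π' : ProofTerm F} (h : Step π π') (σ : Subst F) (θ : ℕ → ProofTerm F) :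
    Step (π.subst σ θ) (π'.subst σ θ) := by
  induction h generalizing σ θ with
  | fst_pair => exact .fst_pair _ _
  | snd_pair => exact .snd_pair _ _
  | cases_inl π₁ π₂ π₃ =>
    have h := Step.cases_inl (π₁.subst σ θ) (π₂.subst σ (upHyp θ)) (π₃.subst σ (upHyp θ))
    rw [subst_upHyp_instHyp] at h
    rw [subst_subst, instHyp_subst]
    exact h
  | cases_inr π₁ π₂ π₃ =>
    have h := Step.cases_inr (π₁.subst σ θ) (π₂.subst σ (upHyp θ)) (π₃.subst σ (upHyp θ))
    rw [subst_upHyp_instHyp] at h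
    rw [subst_subst, instHyp_subst]
    exact h
  | app_lam π₁ π₂ =>
    have h := Step.app_lam (π₁.subst σ (upHyp θ)) (π₂.subst σ θ)
    rw [subst_upHyp_instHyp] at h
    rw [subst_subst, instHyp_subst]
    exact h
  | @tapp_tlam s π t =>
    have h := Step.tapp_tlam (π.subst (σ.up s) (upVar s θ)) (t.subst σ)
    rw [subst_up_inst] at h
    rw [subst_subst, Subst.inst_subst]
    exact h
  | @unpack_tpair s t π₁ π₂ =>
    have h := Step.unpack_tpair (t.subst σ) (π₁.subst σ θ)
      (π₂.subst (σ.up s) (upHyp (upVar s θ)))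
    rw [subst_up_inst_instHyp] at h
    rw [subst_subst, Subst.inst_subst, instHyp_subst]
    exact h
  | botElim _ ih => exact .botElim (ih σ θ)
  | pair_left _ _ ih => exact .pair_left _ (ih σ θ)
  | pair_right _ _ ih => exact .pair_right _ (ih σ θ)
  | fst _ ih => exact .fst (ih σ θ)
  | snd _ ih => exact .snd (ih σ θ)
  | inl _ ih => exact .inl (ih σ θ)
  | inr _ ih => exact .inr (ih σ θ)
  | cases_arg _ _ _ ih => exact .cases_arg _ _ (ih σ θ)
  | cases_left _ _ _ ih => exact .cases_left _ _ (ih σ _)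
  | cases_right _ _ _ ih => exact .cases_right _ _ (ih σ _)
  | lam _ ih => exact .lam (ih σ _)
  | app_left _ _ ih => exact .app_left _ (ih σ θ)
  | app_right _ _ ih => exact .app_right _ (ih σ θ)
  | tlam s _ ih => exact .tlam s (ih _ _)
  | tapp t _ ih => exact .tapp _ (ih σ θ)
  | tpair t _ ih => exact .tpair _ (ih σ θ)
  | unpack_arg s _ _ ih => exact .unpack_arg s _ (ih σ θ)
  | unpack_body s _ _ ih => exact .unpack_body s _ (ih _ _)

/-- A proof-term has finitely many redexes, and a redex at the root has at most one contractum; the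
latter is what the `Subsingleton` sets express. With finite branching settled, `SN` reduces to
well-foundedness of reduction (`SN.of_step`). -/
theorem finite_step (π : ProofTerm F) : {π' | Step π π'}.Finite := by
  induction π with
  | hyp n => exact Set.Finite.subset Set.finite_empty (fun _ h => by cases h)
  | triv => exact Set.Finite.subset Set.finite_empty (fun _ h => by cases h)
  | botElim π ih =>
    refine (ih.image ProofTerm.botElim).subset ?_
    rintro _ (_ | _)
    exact ⟨_, ‹_›, rfl⟩
  | pair π₁ π₂ ih₁ ih₂ =>
    refine ((ih₁.image (ProofTerm.pair · π₂)).union (ih₂.image (ProofTerm.pair π₁))).subset ?_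
    intro _ h
    cases h with
    | pair_left _ h => exact .inl ⟨_, h, rfl⟩
    | pair_right _ h => exact .inr ⟨_, h, rfl⟩
  | fst π ih =>
    have hs : {π' | ∃ ρ, π = .pair π' ρ}.Subsingleton := by
      rintro _ ⟨_, rfl⟩ _ ⟨_, h⟩; cases h; rfl
    refine ((ih.image ProofTerm.fst).union hs.finite).subset ?_
    intro _ h
    cases h with
    | fst h => exact .inl ⟨_, h, rfl⟩
    | fst_pair => exact .inr ⟨_, rfl⟩
  | snd π ih =>
    have hs : {π' | ∃ ρ, π = .pair ρ π'}.Subsingleton := by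
      rintro _ ⟨_, rfl⟩ _ ⟨_, h⟩; cases h; rfl
    refine ((ih.image ProofTerm.snd).union hs.finite).subset ?_
    intro _ h
    cases h with
    | snd h => exact .inl ⟨_, h, rfl⟩
    | snd_pair => exact .inr ⟨_, rfl⟩
  | inl π ih =>
    refine (ih.image ProofTerm.inl).subset ?_
    rintro _ (_ | _)
    exact ⟨_, ‹_›, rfl⟩
  | inr π ih =>
    refine (ih.image ProofTerm.inr).subset ?_
    rintro _ (_ | _)
    exact ⟨_, ‹_›, rfl⟩
  | cases π₁ π₂ π₃ ih₁ ih₂ ih₃ =>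
    have hl : {π' | ∃ ρ, π₁ = .inl ρ ∧ π' = π₂.subst Term.var (instHyp ρ)}.Subsingleton := by
      rintro _ ⟨_, rfl, rfl⟩ _ ⟨_, h, rfl⟩; cases h; rfl
    have hr : {π' | ∃ ρ, π₁ = .inr ρ ∧ π' = π₃.subst Term.var (instHyp ρ)}.Subsingleton := by
      rintro _ ⟨_, rfl, rfl⟩ _ ⟨_, h, rfl⟩; cases h; rfl
    refine ((((ih₁.image (ProofTerm.cases · π₂ π₃)).union
      (ih₂.image (ProofTerm.cases π₁ · π₃))).union (ih₃.image (ProofTerm.cases π₁ π₂))).union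
      (hl.finite.union hr.finite)).subset ?_
    intro _ h
    cases h with
    | cases_inl => exact .inr (.inl ⟨_, rfl, rfl⟩)
    | cases_inr => exact .inr (.inr ⟨_, rfl, rfl⟩)
    | cases_arg _ _ h => exact .inl (.inl (.inl ⟨_, h, rfl⟩))
    | cases_left _ _ h => exact .inl (.inl (.inr ⟨_, h, rfl⟩))
    | cases_right _ _ h => exact .inl (.inr ⟨_, h, rfl⟩)
  | lam π ih =>
    refine (ih.image ProofTerm.lam).subset ?_
    rintro _ (_ | _)
    exact ⟨_, ‹_›, rfl⟩
  | app π₁ π₂ ih₁ ih₂ =>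
    have hs : {π' | ∃ ρ, π₁ = .lam ρ ∧ π' = ρ.subst Term.var (instHyp π₂)}.Subsingleton := by
      rintro _ ⟨_, rfl, rfl⟩ _ ⟨_, h, rfl⟩; cases h; rfl
    refine (((ih₁.image (ProofTerm.app · π₂)).union (ih₂.image (ProofTerm.app π₁))).union
      hs.finite).subset ?_
    intro _ h
    cases h with
    | app_lam => exact .inr ⟨_, rfl, rfl⟩
    | app_left _ h => exact .inl (.inl ⟨_, h, rfl⟩)
    | app_right _ h => exact .inl (.inr ⟨_, h, rfl⟩)
  | tlam s π ih =>
    refine (ih.image (ProofTerm.tlam s)).subset ?_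
    rintro _ (_ | _)
    exact ⟨_, ‹_›, rfl⟩
  | @tapp s π t ih =>
    have hs : {π' | ∃ ρ, π = .tlam s ρ ∧ π' = ρ.subst (Subst.inst t) hyp}.Subsingleton := by
      rintro _ ⟨_, rfl, rfl⟩ _ ⟨_, h, rfl⟩; cases h; rfl
    refine ((ih.image (ProofTerm.tapp · t)).union hs.finite).subset ?_
    intro _ h
    cases h with
    | tapp_tlam => exact .inr ⟨_, rfl, rfl⟩
    | tapp _ h => exact .inl ⟨_, h, rfl⟩
  | @tpair s t π ih =>
    refine (ih.image (ProofTerm.tpair t)).subset ?_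
    intro _ h
    cases h with
    | tpair _ h => exact ⟨_, h, rfl⟩
  | unpack s π₁ π₂ ih₁ ih₂ =>
    have hs : {π' | ∃ (t : Term F s) (ρ : _), π₁ = .tpair t ρ ∧
        π' = π₂.subst (Subst.inst t) (instHyp ρ)}.Subsingleton := by
      rintro _ ⟨_, _, rfl, rfl⟩ _ ⟨_, _, h, rfl⟩; cases h; rfl
    refine (((ih₁.image (ProofTerm.unpack s · π₂)).union (ih₂.image (ProofTerm.unpack s π₁))).union
      hs.finite).subset ?_
    intro _ h
    cases h with
    | unpack_tpair => exact .inr ⟨_, _, rfl, rfl⟩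
    | unpack_arg _ _ h => exact .inl (.inl ⟨_, h, rfl⟩)
    | unpack_body _ _ h => exact .inl (.inr ⟨_, h, rfl⟩)

theorem SN.of_step {π : ProofTerm F} (h : ∀ π', Step π π' → SN π') : SN π :=
  .intro π (finite_step π) h

theorem SN.step {π π' : ProofTerm F} (h : SN π) (hs : Step π π') : SN π' := by
  cases h with
  | intro _ _ h => exact h _ hs

/-- Reductions of a term are copied by its instances, so an infinite one cannot disappear under
substitution. This gives normalization of bodies under binders, which are known only through their
instances. -/
theorem SN.of_subst {σ : Subst F} {θ : ℕ → ProofTerm F} {π : ProofTerm F}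
    (h : SN (π.subst σ θ)) : SN π := by
  generalize hρ : π.subst σ θ = ρ at h
  induction h generalizing π with
  | intro ρ _ _ ih =>
    subst hρ
    exact .of_step fun π' hs => ih _ (hs.subst σ θ) rfl

end ProofTerm
end Logic
end DeductionModulo

namespace DeductionModulo

/-! ### Reducibility candidates and the operations of the connectives -/

section Logic

variable {S : Type} {F G : (n : ℕ) → (Fin n → S) → S → Type}
  {R : (n : ℕ) → (Fin n → S) → Type}

namespace ProofTerm

/-- The proof-terms that end with an introduction rule. -/
def IsIntro : ProofTerm F → Prop
  | triv => True
  | pair _ _ => True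
  | inl _ => True
  | inr _ => True
  | lam _ => True
  | tlam _ _ => True
  | tpair _ _ => True
  | _ => False

variable [DecidableEq S]

/-- The reducibility candidate defined by a set `V` of values: the strongly normalizing
proof-terms all of whose reducts that end with an introduction belong to `V`. -/
inductive Realizes (V : Set (ProofTerm F)) : ProofTerm F → Prop
  | intro (π : ProofTerm F) (hV : IsIntro π → π ∈ V) (h : ∀ π', Step π π' → Realizes V π') :
      Realizes V π

/-- The values of a conjunction. -/
def andVal (A B : Set (ProofTerm F)) : Set (ProofTerm F) :=
  {π | ∀ π₁ π₂, π = pair π₁ π₂ → Realizes A π₁ ∧ Realizes B π₂}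

/-- The values of a disjunction. -/
def orVal (A B : Set (ProofTerm F)) : Set (ProofTerm F) :=
  {π | (∀ π', π = inl π' → Realizes A π') ∧ ∀ π', π = inr π' → Realizes B π'}

/-- The values of an implication. -/
def impVal (A B : Set (ProofTerm F)) : Set (ProofTerm F) :=
  {π | ∀ π', π = lam π' → ∀ ρ, Realizes A ρ → Realizes B (π'.subst Term.var (instHyp ρ))}

/-- The values of a universal quantification over the sort `s`. -/
def allVal (s : S) {D : Type} (V : D → Set (ProofTerm F)) : Set (ProofTerm F) :=
  {π | ∀ π', π = tlam s π' → ∀ (d : D) (t : Term F s),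
    Realizes (V d) (π'.subst (Subst.inst t) ProofTerm.hyp)}

/-- The values of an existential quantification over the sort `s`. -/
def exVal (s : S) {D : Type} (V : D → Set (ProofTerm F)) : Set (ProofTerm F) :=
  {π | ∀ (t : Term F s) (π' : ProofTerm F), π = tpair t π' → ∃ d, Realizes (V d) π'}

variable {A B C : Set (ProofTerm F)}

theorem Realizes.step {π π' : ProofTerm F} (h : Realizes A π) (hs : Step π π') :
    Realizes A π' := by
  cases h with
  | intro _ _ h => exact h _ hs

theorem Realizes.sn {π : ProofTerm F} (h : Realizes A π) : SN π := by
  induction h with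
  | intro π _ _ ih => exact .of_step ih

/-- Gives the variance of the operations on truth values, needed for the fixed point that interprets
`N`. -/
theorem Realizes.mono (hAB : A ⊆ B) {π : ProofTerm F} (h : Realizes A π) : Realizes B π := by
  induction h with
  | intro π hV _ ih => exact .intro π (fun hi => hAB (hV hi)) ih

/-- A variable is normal and not an introduction, so nothing is required of it. -/
theorem Realizes.hyp (A : Set (ProofTerm F)) (n : ℕ) : Realizes A (hyp n) :=
  .intro _ False.elim (fun _ h => by cases h)

theorem Realizes.triv : Realizes Set.univ (triv : ProofTerm F) :=
  .intro _ (fun _ => Set.mem_univ _) (fun _ h => by cases h)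

/-- All reducts are again of the form `botElim`, never an introduction, so strong normalization of
the premise suffices for any candidate. -/
theorem Realizes.botElim {π : ProofTerm F} (h : SN π) : Realizes A (botElim π) := by
  induction h with
  | intro π _ _ ih =>
    refine .intro _ False.elim fun π' hs => ?_
    cases hs with
    | botElim h => exact ih _ h

theorem Realizes.pair {π₁ π₂ : ProofTerm F} (h₁ : Realizes A π₁) (h₂ : Realizes B π₂) :
    Realizes (andVal A B) (pair π₁ π₂) := by
  induction h₁ generalizing π₂ with
  | intro π₁ hV₁ hs₁ ih₁ =>
    induction h₂ with
    | intro π₂ hV₂ hs₂ ih₂ =>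
      refine .intro _ (fun _ => ?_) fun π' hs => ?_
      · rintro _ _ ⟨⟩
        exact ⟨.intro _ hV₁ hs₁, .intro _ hV₂ hs₂⟩
      · cases hs with
        | pair_left _ h => exact ih₁ _ h (.intro _ hV₂ hs₂)
        | pair_right _ h => exact ih₂ _ h

/-- The pattern of all eliminations: the term is not an introduction, so only its reducts matter. A
step inside the premise is covered by induction; a contraction at the root means that the premise is
an introduction, hence a value. -/
theorem Realizes.fst {π : ProofTerm F} (h : Realizes (andVal A B) π) : Realizes A (fst π) := by
  induction h with
  | intro π hV _ ih =>
    refine .intro _ False.elim fun π' hs => ?_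
    cases hs with
    | fst_pair => exact (hV trivial _ _ rfl).1
    | fst h => exact ih _ h

theorem Realizes.snd {π : ProofTerm F} (h : Realizes (andVal A B) π) : Realizes B (snd π) := by
  induction h with
  | intro π hV _ ih =>
    refine .intro _ False.elim fun π' hs => ?_
    cases hs with
    | snd_pair => exact (hV trivial _ _ rfl).2
    | snd h => exact ih _ h

theorem Realizes.inl {π : ProofTerm F} (h : Realizes A π) : Realizes (orVal A B) (inl π) := by
  induction h with
  | intro π hV hs ih =>
    refine .intro _ (fun _ => ⟨?_, ?_⟩) fun π' hs => ?_
    · rintro _ ⟨⟩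
      exact .intro _ hV hs
    · rintro _ ⟨⟩
    · cases hs with
      | inl h => exact ih _ h

theorem Realizes.inr {π : ProofTerm F} (h : Realizes B π) : Realizes (orVal A B) (inr π) := by
  induction h with
  | intro π hV hs ih =>
    refine .intro _ (fun _ => ⟨?_, ?_⟩) fun π' hs => ?_
    · rintro _ ⟨⟩
    · rintro _ ⟨⟩
      exact .intro _ hV hs
    · cases hs with
      | inr h => exact ih _ h

theorem Realizes.cases {π₁ π₂ π₃ : ProofTerm F} (h₁ : Realizes (orVal A B) π₁)
    (h₂ : ∀ ρ, Realizes A ρ → Realizes C (π₂.subst Term.var (instHyp ρ)))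
    (h₃ : ∀ ρ, Realizes B ρ → Realizes C (π₃.subst Term.var (instHyp ρ))) :
    Realizes C (cases π₁ π₂ π₃) := by
  -- Instantiating the bound hypothesis by a variable shows that the branches normalize, so that
  -- their own reductions can be used for induction.
  have n₂ : SN π₂ := (h₂ _ (.hyp A 0)).sn.of_subst
  have n₃ : SN π₃ := (h₃ _ (.hyp B 0)).sn.of_subst
  induction h₁ generalizing π₂ π₃ with
  | intro π₁ hV₁ hs₁ ih₁ =>
    induction n₂ generalizing π₃ with
    | intro π₂ hf₂ hn₂ ih₂ =>
      induction n₃ with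
      | intro π₃ hf₃ hn₃ ih₃ =>
        refine .intro _ False.elim fun π' hs => ?_
        cases hs with
        | cases_inl => exact h₂ _ ((hV₁ trivial).1 _ rfl)
        | cases_inr => exact h₃ _ ((hV₁ trivial).2 _ rfl)
        | cases_arg _ _ h => exact ih₁ _ h h₂ h₃ (.intro _ hf₂ hn₂) (.intro _ hf₃ hn₃)
        | cases_left _ _ h =>
          -- The assumption on the branch survives its reduction because steps are stable under
          -- substitution.
          exact ih₂ _ h (fun ρ hρ => (h₂ ρ hρ).step (h.subst _ _)) h₃ (.intro _ hf₃ hn₃)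
        | cases_right _ _ h => exact ih₃ _ h fun ρ hρ => (h₃ ρ hρ).step (h.subst _ _)

theorem Realizes.lam {π : ProofTerm F}
    (h : ∀ ρ, Realizes A ρ → Realizes B (π.subst Term.var (instHyp ρ))) :
    Realizes (impVal A B) (lam π) := by
  have n : SN π := (h _ (.hyp A 0)).sn.of_subst
  induction n with
  | intro π _ _ ih =>
    refine .intro _ (fun _ => ?_) fun π' hs => ?_
    · rintro _ ⟨⟩
      exact h
    · cases hs with
      | lam hs => exact ih _ hs fun ρ hρ => (h ρ hρ).step (hs.subst _ _)

theorem Realizes.app {π₁ π₂ : ProofTerm F} (h₁ : Realizes (impVal A B) π₁)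
    (h₂ : Realizes A π₂) : Realizes B (app π₁ π₂) := by
  induction h₁ generalizing π₂ with
  | intro π₁ hV₁ hs₁ ih₁ =>
    induction h₂ with
    | intro π₂ hV₂ hs₂ ih₂ =>
      refine .intro _ False.elim fun π' hs => ?_
      cases hs with
      | app_lam => exact hV₁ trivial _ rfl _ (.intro _ hV₂ hs₂)
      | app_left _ h => exact ih₁ _ h (.intro _ hV₂ hs₂)
      | app_right _ h => exact ih₂ _ h

variable {s : S} {D : Type} {V : D → Set (ProofTerm F)}

/-- A nonempty domain provides at least one instance of the body, from which its normalization
follows. The element `d` and the term `t` vary independently: no term need denote `d`. -/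
theorem Realizes.tlam [Nonempty D] {π : ProofTerm F}
    (h : ∀ (d : D) (t : Term F s), Realizes (V d) (π.subst (Subst.inst t) ProofTerm.hyp)) :
    Realizes (allVal s V) (tlam s π) := by
  have n : SN π := (h (Classical.arbitrary D) (.var s 0)).sn.of_subst
  induction n with
  | intro π _ _ ih =>
    refine .intro _ (fun _ => ?_) fun π' hs => ?_
    · rintro _ ⟨⟩
      exact h
    · cases hs with
      | tlam _ hs => exact ih _ hs fun d t => (h d t).step (hs.subst _ _)

theorem Realizes.tapp {π : ProofTerm F} (h : Realizes (allVal s V) π) (d : D) (t : Term F s) :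
    Realizes (V d) (tapp π t) := by
  induction h with
  | intro π hV hs ih =>
    refine .intro _ False.elim fun π' hs => ?_
    cases hs with
    | tapp_tlam => exact hV trivial _ rfl d t
    | tapp _ h => exact ih _ h

theorem Realizes.tpair {π : ProofTerm F} (t : Term F s) {d : D} (h : Realizes (V d) π) :
    Realizes (exVal s V) (tpair t π) := by
  induction h with
  | intro π hV hs ih =>
    refine .intro _ (fun _ => ?_) fun π' hs => ?_
    · rintro _ _ ⟨⟩
      exact ⟨d, .intro _ hV hs⟩
    · cases hs with
      | tpair _ h => exact ih _ h

theorem Realizes.unpack [Nonempty D] {π₁ π₂ : ProofTerm F} (h₁ : Realizes (exVal s V) π₁)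
    (h₂ : ∀ (d : D) (t : Term F s) (ρ : ProofTerm F), Realizes (V d) ρ →
      Realizes C (π₂.subst (Subst.inst t) (instHyp ρ))) :
    Realizes C (unpack s π₁ π₂) := by
  have n₂ : SN π₂ := (h₂ (Classical.arbitrary D) (.var s 0) _ (.hyp _ 0)).sn.of_subst
  induction h₁ generalizing π₂ with
  | intro π₁ hV₁ hs₁ ih₁ =>
    induction n₂ with
    | intro π₂ hf₂ hn₂ ih₂ =>
      refine .intro _ False.elim fun π' hs => ?_
      cases hs with
      | unpack_tpair =>
        obtain ⟨d, hd⟩ := hV₁ trivial _ _ rfl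
        exact h₂ d _ _ hd
      | unpack_arg _ _ h => exact ih₁ _ h h₂ (.intro _ hf₂ hn₂)
      | unpack_body _ _ h => exact ih₂ _ h fun d t ρ hρ => (h₂ d t ρ hρ).step (h.subst _ _)

/-- Contravariant on the left because a larger set of values generates a larger candidate of
arguments. -/
theorem impVal_mono {A' B' : Set (ProofTerm F)} (hA : A' ⊆ A) (hB : B ⊆ B') :
    impVal A B ⊆ impVal A' B' :=
  fun _ h π' hπ ρ hρ => (h π' hπ ρ (hρ.mono hA)).mono hB

theorem allVal_mono {W : D → Set (ProofTerm F)} (h : ∀ d, V d ⊆ W d) : allVal s V ⊆ allVal s W :=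
  fun _ hπ π' e d t => (hπ π' e d t).mono (h d)

end ProofTerm

/-! ### Models valued in sets of proof-terms -/

open ProofTerm

/-- A model with domains `D` whose truth values are sets of proof-terms. -/
structure Model (D : S → Type) (F : (n : ℕ) → (Fin n → S) → S → Type)
    (R : (n : ℕ) → (Fin n → S) → Type) (G : (n : ℕ) → (Fin n → S) → S → Type) where
  fn {n : ℕ} {ss : Fin n → S} {s : S} : F n ss s → ((i : Fin n) → D (ss i)) → D s
  rel {n : ℕ} {ss : Fin n → S} : R n ss → ((i : Fin n) → D (ss i)) → Set (ProofTerm G)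

/-- Valuations of the variables. -/
abbrev Valuation (D : S → Type) : Type := (s : S) → ℕ → D s

variable {D : S → Type}

/-- The value of a term. -/
def Model.eval (M : Model D F R G) (v : Valuation D) : {s : S} → Term F s → D s
  | _, .var s n => v s n
  | _, .app f ts => M.fn f (fun i => M.eval v (ts i))

theorem Model.eval_rename (M : Model D F R G) (v : Valuation D) (r : S → ℕ → ℕ) {s : S}
    (t : Term F s) : M.eval v (t.rename r) = M.eval (fun s n => v s (r s n)) t := by
  induction t with
  | var s n => rfl
  | app f ts ih => simp only [Term.rename, Model.eval, ih]

theorem Model.eval_subst (M : Model D F R G) (v : Valuation D) (σ : Subst F) {s : S}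
    (t : Term F s) : M.eval v (t.subst σ) = M.eval (fun s n => M.eval v (σ s n)) t := by
  induction t with
  | var s n => rfl
  | app f ts ih => simp only [Term.subst, Model.eval, ih]

theorem Model.eval_congr (M : Model D F R G) {v w : Valuation D} {s : S} (t : Term F s)
    (h : ∀ x ∈ t.FV, v x.1 x.2 = w x.1 x.2) : M.eval v t = M.eval w t := by
  induction t with
  | var s n => exact h (s, n) rfl
  | app f ts ih =>
    simp only [Model.eval]
    congr 1
    funext i
    exact ih i fun x hx => h x (Set.mem_iUnion.2 ⟨i, hx⟩)

theorem Model.eval_mapFn {F' : (n : ℕ) → (Fin n → S) → S → Type} (M : Model D F R G)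
    (M' : Model D F' R G) (e : {n : ℕ} → {ss : Fin n → S} → {s : S} → F n ss s → F' n ss s)
    (hfn : ∀ {n : ℕ} {ss : Fin n → S} {s : S} (f : F n ss s), M'.fn (e f) = M.fn f)
    (v : Valuation D) {s : S} (t : Term F s) : M'.eval v (t.mapFn e) = M.eval v t := by
  induction t with
  | var s n => rfl
  | app f ts ih => simp only [Term.mapFn, Model.eval, ih, hfn]

variable [DecidableEq S]

/-- The valuation that extends `v` by `d` for the variable number `0` of sort `s`. -/
def Valuation.cons {s : S} (d : D s) (v : Valuation D) : Valuation D := fun s' n =>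
  if h : s' = s then
    match n with
    | 0 => h ▸ d
    | n + 1 => v s' n
  else v s' n

theorem Valuation.cons_shift {s : S} (d : D s) (v : Valuation D) :
    (fun s' n => Valuation.cons d v s' (shift s s' n)) = v := by
  funext s' n
  by_cases h : s' = s
  · subst h; simp [Valuation.cons, shift]
  · simp [Valuation.cons, shift, h]

theorem Valuation.cons_upRen {s : S} (d : D s) (v : Valuation D) (r : S → ℕ → ℕ) :
    (fun s' n => Valuation.cons d v s' (upRen s r s' n)) =
      Valuation.cons d (fun s' n => v s' (r s' n)) := by
  funext s' n
  by_cases h : s' = s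
  · subst h; cases n <;> simp [Valuation.cons, upRen]
  · simp [Valuation.cons, upRen, h]

theorem Model.eval_up (M : Model D F R G) {s : S} (d : D s) (v : Valuation D) (σ : Subst F) :
    (fun s' n => M.eval (Valuation.cons d v) (σ.up s s' n)) =
      Valuation.cons d (fun s' n => M.eval v (σ s' n)) := by
  funext s' n
  by_cases h : s' = s
  · subst h
    cases n <;> simp [Subst.up, Model.eval_rename, Valuation.cons_shift]
    · simp [Model.eval, Valuation.cons]
    · simp [Valuation.cons]
  · simp [Subst.up, h, Model.eval_rename, Valuation.cons_shift]
    simp [Valuation.cons, h]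

theorem Model.eval_inst (M : Model D F R G) {s : S} (t : Term F s) (v : Valuation D) :
    (fun s' n => M.eval v (Subst.inst t s' n)) = Valuation.cons (M.eval v t) v := by
  funext s' n
  by_cases h : s' = s
  · subst h; cases n <;> simp [Subst.inst, Valuation.cons, Model.eval]
  · simp [Subst.inst, Valuation.cons, Model.eval, h]

/-- The truth value of a proposition. -/
def Model.interp (M : Model D F R G) : Valuation D → Formula F R → Set (ProofTerm G)
  | v, .rel P ts => M.rel P (fun i => M.eval v (ts i))
  | _, .top => Set.univ
  -- No introduction rule concludes `⊥`, so its eliminations need only strong normalization, which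
  -- is all that `Set.univ` demands.
  | _, .bot => Set.univ
  | v, .and A B => andVal (M.interp v A) (M.interp v B)
  | v, .or A B => orVal (M.interp v A) (M.interp v B)
  | v, .imp A B => impVal (M.interp v A) (M.interp v B)
  | v, .all s A => allVal s (fun d => M.interp (Valuation.cons (s := s) d v) A)
  | v, .ex s A => exVal s (fun d => M.interp (Valuation.cons (s := s) d v) A)

theorem Model.interp_rename (M : Model D F R G) (v : Valuation D) (r : S → ℕ → ℕ)
    (A : Formula F R) : M.interp v (A.rename r) = M.interp (fun s n => v s (r s n)) A := by
  induction A generalizing v r <;>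
    simp_all only [Formula.rename, Model.interp, Model.eval_rename, Valuation.cons_upRen]

theorem Model.interp_subst (M : Model D F R G) (v : Valuation D) (σ : Subst F)
    (A : Formula F R) : M.interp v (A.subst σ) = M.interp (fun s n => M.eval v (σ s n)) A := by
  induction A generalizing v σ <;>
    simp_all only [Formula.subst, Model.interp, Model.eval_subst, Model.eval_up]

/-- Makes the value of a comprehension class independent of the valuation chosen outside its listed
variables. -/
theorem Model.interp_congr (M : Model D F R G) {v w : Valuation D} (A : Formula F R)
    (h : ∀ x ∈ A.FV, v x.1 x.2 = w x.1 x.2) : M.interp v A = M.interp w A := by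
  have hcons : ∀ (s : S) (A : Formula F R) (v w : Valuation D) (d : D s),
      (∀ x ∈ {x : S × ℕ | (x.1, shift s x.1 x.2) ∈ A.FV}, v x.1 x.2 = w x.1 x.2) →
      ∀ x ∈ A.FV, Valuation.cons d v x.1 x.2 = Valuation.cons d w x.1 x.2 := by
    rintro s A v w d h ⟨s', n⟩ hx
    by_cases hs : s' = s
    · subst hs
      cases n with
      | zero => simp [Valuation.cons]
      | succ n =>
        have := h (s', n) (by simpa [shift] using hx)
        simpa [Valuation.cons] using this
    · have := h (s', n) (by simpa [shift, hs] using hx)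
      simpa [Valuation.cons, hs] using this
  induction A generalizing v w with
  | rel P ts =>
    simp only [Model.interp]
    congr 1
    funext i
    exact M.eval_congr _ fun x hx => h x (Set.mem_iUnion.2 ⟨i, hx⟩)
  | top => rfl
  | bot => rfl
  | and A B ihA ihB =>
    simp only [Model.interp, ihA fun x hx => h x (.inl hx), ihB fun x hx => h x (.inr hx)]
  | or A B ihA ihB =>
    simp only [Model.interp, ihA fun x hx => h x (.inl hx), ihB fun x hx => h x (.inr hx)]
  | imp A B ihA ihB =>
    simp only [Model.interp, ihA fun x hx => h x (.inl hx), ihB fun x hx => h x (.inr hx)]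
  | all s A ih => simp only [Model.interp, fun d => ih (hcons s A v w d h)]
  | ex s A ih => simp only [Model.interp, fun d => ih (hcons s A v w d h)]

/-- Transfers the value of a comprehension formula from the base language to the full language. -/
theorem Model.interp_mapFn {F' : (n : ℕ) → (Fin n → S) → S → Type} (M : Model D F R G)
    (M' : Model D F' R G) (e : {n : ℕ} → {ss : Fin n → S} → {s : S} → F n ss s → F' n ss s)
    (hfn : ∀ {n : ℕ} {ss : Fin n → S} {s : S} (f : F n ss s), M'.fn (e f) = M.fn f)
    (hrel : ∀ {n : ℕ} {ss : Fin n → S} (P : R n ss), M'.rel P = M.rel P)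
    (v : Valuation D) (A : Formula F R) : M'.interp v (A.mapFn e) = M.interp v A := by
  induction A generalizing v <;>
    simp_all only [Formula.mapFn, Model.interp, M.eval_mapFn M' e hfn]

/-! ### Soundness of deduction modulo -/

/-- A model of a theory modulo: the two sides of each rule have the same value. -/
structure Model.Validates (M : Model D F R G) (E : RewriteSystem F R) : Prop where
  termRule {s : S} {l r : Term F s} (h : E.termRule l r) (v : Valuation D) : M.eval v l = M.eval v r
  propRule {l r : Formula F R} (h : E.propRule l r) (v : Valuation D) :
    M.interp v l = M.interp v r

theorem Model.Validates.termCongr {M : Model D F R G} {E : RewriteSystem F R} (hM : M.Validates E)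
    {s : S} {t u : Term F s} (h : E.TermCongr t u) (v : Valuation D) :
    M.eval v t = M.eval v u := by
  induction h with
  | rule h σ => rw [M.eval_subst, M.eval_subst, hM.termRule h]
  | refl => rfl
  | symm _ ih => exact ih.symm
  | trans _ _ ih₁ ih₂ => exact ih₁.trans ih₂
  | app f _ ih => simp only [Model.eval, ih]

/-- Substitution instances of a rule come for free: the value of an instance is the value of the
original under the valuation composed with the substitution. -/
theorem Model.Validates.congr {M : Model D F R G} {E : RewriteSystem F R} (hM : M.Validates E)
    {A B : Formula F R} (h : E.Congr A B) (v : Valuation D) : M.interp v A = M.interp v B := by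
  induction h generalizing v with
  | rule h σ => rw [M.interp_subst, M.interp_subst, hM.propRule h]
  | refl => rfl
  | symm _ ih => exact (ih v).symm
  | trans _ _ ih₁ ih₂ => exact (ih₁ v).trans (ih₂ v)
  | rel P h => simp only [Model.interp, fun i => hM.termCongr (h i) v]
  | and _ _ ih₁ ih₂ => simp only [Model.interp, ih₁, ih₂]
  | or _ _ ih₁ ih₂ => simp only [Model.interp, ih₁, ih₂]
  | imp _ _ ih₁ ih₂ => simp only [Model.interp, ih₁, ih₂]
  | all s _ ih => simp only [Model.interp, ih]
  | ex s _ ih => simp only [Model.interp, ih]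

/-- `θ` substitutes realizers for the hypotheses of `Γ`. -/
def Model.RealizesCtx (M : Model D F R G) (v : Valuation D) (Γ : List (Formula F R))
    (θ : ℕ → ProofTerm G) : Prop :=
  ∀ (n : ℕ) (A : Formula F R), Γ[n]? = some A → Realizes (M.interp v A) (θ n)

theorem Model.RealizesCtx.cons {M : Model D F R G} {v : Valuation D} {Γ : List (Formula F R)}
    {θ : ℕ → ProofTerm G} (h : M.RealizesCtx v Γ θ) {A : Formula F R} {ρ : ProofTerm G}
    (hρ : Realizes (M.interp v A) ρ) : M.RealizesCtx v (A :: Γ) (consHyp ρ θ) := by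
  intro n B hB
  cases n with
  | zero =>
    obtain rfl : A = B := by simpa using hB
    exact hρ
  | succ n => exact h n B (by simpa using hB)

theorem Model.interp_shift (M : Model D F R G) {s : S} (d : D s) (v : Valuation D)
    (A : Formula F R) : M.interp (Valuation.cons d v) (A.rename (shift s)) = M.interp v A := by
  rw [M.interp_rename, Valuation.cons_shift]

theorem Model.RealizesCtx.shift {M : Model D F R G} {v : Valuation D} {Γ : List (Formula F R)}
    {θ : ℕ → ProofTerm G} (h : M.RealizesCtx v Γ θ) {s : S} (d : D s) :
    M.RealizesCtx (Valuation.cons d v) (Γ.map (Formula.rename (shift s))) θ := by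
  intro n B hB
  rw [List.getElem?_map, Option.map_eq_some_iff] at hB
  obtain ⟨A, hA, rfl⟩ := hB
  rw [M.interp_shift]
  exact h n A hA

/-- The valuation `v` and the substitution `σ` are unrelated, since truth values depend on elements
of the domains and not on the terms in proofs. This freedom is what `∀`-introduction and
`∃`-elimination need, where `d` and `t` are arbitrary. -/
theorem Model.Validates.realizes [∀ s, Nonempty (D s)] {M : Model D F R F}
    {E : RewriteSystem F R} (hM : M.Validates E) {Γ : List (Formula F R)} {π : ProofTerm F}
    {A : Formula F R} (h : E.Proves Γ π A) (v : Valuation D) (σ : Subst F) {θ : ℕ → ProofTerm F}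
    (hθ : M.RealizesCtx v Γ θ) : Realizes (M.interp v A) (π.subst σ θ) := by
  induction h generalizing v σ θ with
  | ax hn hc => exact hM.congr hc v ▸ hθ _ _ hn
  | topIntro hc => exact hM.congr hc v ▸ .triv
  | botElim hc _ ih => exact .botElim (ih v σ hθ).sn
  | andIntro hc _ _ ih₁ ih₂ => exact hM.congr hc v ▸ .pair (ih₁ v σ hθ) (ih₂ v σ hθ)
  | andLeft hc _ ih => exact .fst (hM.congr hc v ▸ ih v σ hθ)
  | andRight hc _ ih => exact .snd (hM.congr hc v ▸ ih v σ hθ)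
  | orLeft hc _ ih => exact hM.congr hc v ▸ .inl (ih v σ hθ)
  | orRight hc _ ih => exact hM.congr hc v ▸ .inr (ih v σ hθ)
  | orElim hc _ _ _ ih₁ ih₂ ih₃ =>
    refine .cases (hM.congr hc v ▸ ih₁ v σ hθ) (fun ρ hρ => ?_) (fun ρ hρ => ?_)
    · rw [subst_upHyp_instHyp]
      exact ih₂ v σ (hθ.cons hρ)
    · rw [subst_upHyp_instHyp]
      exact ih₃ v σ (hθ.cons hρ)
  | impIntro hc _ ih =>
    refine hM.congr hc v ▸ .lam fun ρ hρ => ?_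
    rw [subst_upHyp_instHyp]
    exact ih v σ (hθ.cons hρ)
  | impElim hc _ _ ih₁ ih₂ =>
    have h := ih₁ v σ hθ
    rw [hM.congr hc v] at h
    exact h.app (ih₂ v σ hθ)
  | allIntro hc _ ih =>
    refine hM.congr hc v ▸ .tlam fun d t => ?_
    rw [subst_up_inst]
    exact ih _ _ (hθ.shift d)
  | allElim t hc hc' _ ih =>
    have h := ih v σ hθ
    rw [hM.congr hc v] at h
    rw [hM.congr hc' v, M.interp_subst, M.eval_inst]
    exact h.tapp _ _
  | exIntro t hc hc' _ ih =>
    have h := ih v σ hθ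
    rw [hM.congr hc' v, M.interp_subst, M.eval_inst] at h
    rw [hM.congr hc v]
    exact Realizes.tpair (V := fun d => M.interp (Valuation.cons d v) _) _ h
  | exElim hc _ _ ih₁ ih₂ =>
    refine .unpack (hM.congr hc v ▸ ih₁ v σ hθ) fun d t ρ hρ => ?_
    -- By the eigenvariable condition, the conclusion keeps its value when the valuation is extended
    -- by `d`.
    rw [subst_up_inst_instHyp, ← M.interp_shift d v]
    exact ih₂ _ _ ((hθ.shift d).cons hρ)

/-- The hypotheses are realized by the proof variables themselves, under any valuation. -/
theorem Model.Validates.sn [∀ s, Nonempty (D s)] {M : Model D F R F} {E : RewriteSystem F R}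
    (hM : M.Validates E) {Γ : List (Formula F R)} {π : ProofTerm F} {A : Formula F R}
    (h : E.Proves Γ π A) : SN π :=
  (hM.realizes h (fun _ _ => Classical.arbitrary _) Term.var
    (fun n _ _ => Realizes.hyp _ n)).sn.of_subst

end Logic
end DeductionModulo

namespace DeductionModulo

/-! ### The standard model of arithmetic -/

open ProofTerm Srt

variable {G : (n : ℕ) → (Fin n → Srt) → Srt → Type}

/-- The standard domains: numbers, and maps from numbers to truth values. -/
def ArithDom (G : (n : ℕ) → (Fin n → Srt) → Srt → Type) : Srt → Type
  | ι => ℕ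
  | κ => ℕ → Set (ProofTerm G)

instance (s : Srt) : Nonempty (ArithDom G s) :=
  match s with
  | ι => ⟨(0 : ℕ)⟩
  | κ => ⟨fun _ => Set.univ⟩

/-- The operator of which the interpretation of `N` is the least fixed point. -/
def natOperator (G : (n : ℕ) → (Fin n → Srt) → Srt → Type) :
    (ℕ → Set (ProofTerm G)) →o (ℕ → Set (ProofTerm G)) where
  toFun f n := allVal κ (fun X : ℕ → Set (ProofTerm G) => impVal (X 0)
    (impVal (allVal ι (fun y : ℕ => impVal (f y) (impVal (X y) (X (y + 1))))) (X n)))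
  -- The argument `f` occurs to the left of exactly two implications, hence positively.
  monotone' _ _ h _ :=
    allVal_mono fun _ => impVal_mono le_rfl (impVal_mono
      (allVal_mono fun y => impVal_mono (h y) le_rfl) le_rfl)

/-- The interpretation of the function symbols other than the comprehension symbols. -/
def baseFn : {n : ℕ} → {ss : Fin n → Srt} → {s : Srt} → BaseFn n ss s →
    ((i : Fin n) → ArithDom G (ss i)) → ArithDom G s
  | _, _, _, .zero, _ => (0 : ℕ)
  | _, _, _, .succ, a => Nat.succ (a 0)
  | _, _, _, .pred, a => Nat.pred (a 0)
  | _, _, _, .add, a => Nat.add (a 0) (a 1)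
  | _, _, _, .mul, a => Nat.mul (a 0) (a 1)

/-- The interpretation of the predicate symbols. -/
def arithRel : {n : ℕ} → {ss : Fin n → Srt} → ArithRel n ss →
    ((i : Fin n) → ArithDom G (ss i)) → Set (ProofTerm G)
  | _, _, .eq, a => allVal κ (fun X : ℕ → Set (ProofTerm G) => impVal (X (a 0)) (X (a 1)))
  | _, _, .nat, a => OrderHom.lfp (natOperator G) (a 0)
  -- The common value of `⊤` and `⊥`, so both rules for `Null` hold.
  | _, _, .null, _ => Set.univ
  | _, _, .mem, a => (a 1 : ℕ → Set (ProofTerm G)) (a 0)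

/-- The model of the language without comprehension symbols. -/
def baseModel (G : (n : ℕ) → (Fin n → Srt) → Srt → Type) :
    Model (ArithDom G) BaseFn ArithRel G where
  fn := baseFn
  rel := arithRel

/-- The class of the `n` such that `A`, for given values `a` of the parameters. -/
noncomputable def comprehension (c : Abstraction) (a : (i : Fin c.n) → ArithDom G (c.y i).1) :
    ArithDom G κ := fun n : ℕ =>
  -- Any valuation with the prescribed values at `x` and the `yᵢ` serves, since these cover the free
  -- variables. Interpreting `A` in the base model avoids circularity: `A` contains no comprehension
  -- symbol, while its values already consist of proof-terms over `G`.
  (baseModel G).interp (Classical.epsilon fun v : Valuation (ArithDom G) =>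
    v ι c.x = n ∧ ∀ i, v (c.y i).1 (c.y i).2 = a i) c.A

/-- The valuation `v` itself witnesses that the choice made by `Classical.epsilon` is satisfiable,
and the chosen valuation agrees with `v` on the free variables of `c.A`. -/
theorem comprehension_apply (c : Abstraction) (v : Valuation (ArithDom G)) :
    (comprehension c (fun i => v (c.y i).1 (c.y i).2) : ℕ → Set (ProofTerm G)) (v ι c.x) =
      (baseModel G).interp v c.A := by
  have hε := Classical.epsilon_spec (p := fun w : Valuation (ArithDom G) =>
    w ι c.x = v ι c.x ∧ ∀ i, w (c.y i).1 (c.y i).2 = v (c.y i).1 (c.y i).2) ⟨v, rfl, fun _ => rfl⟩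
  refine Model.interp_congr _ _ fun x hx => ?_
  rcases c.fv_subset hx with rfl | ⟨i, rfl⟩
  · exact hε.1
  · exact hε.2 i

/-- The standard model of arithmetic with the comprehension scheme `𝒞`. -/
noncomputable def arithModel (𝒞 : Set Abstraction) :
    Model (ArithDom (ArithFn 𝒞)) (ArithFn 𝒞) ArithRel (ArithFn 𝒞) where
  fn f := match f with
    | .base f => baseFn f
    | .skolem c _ => comprehension c
  rel := arithRel

theorem arithModel_validates (𝒞 : Set Abstraction) : (arithModel 𝒞).Validates (HA 𝒞) where
  termRule h v := by
    cases h with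
    | pred_zero => rfl
    | pred_succ => rfl
    | zero_add => exact Nat.zero_add _
    | succ_add => exact Nat.succ_add _ _
    | zero_mul => exact Nat.zero_mul _
    | succ_mul => exact Nat.succ_mul _ _
  propRule h v := by
    cases h with
    | comprehension c hc =>
      rw [(baseModel (ArithFn 𝒞)).interp_mapFn (arithModel 𝒞) _ (fun _ => rfl) (fun _ => rfl)]
      exact comprehension_apply c v
    | eq => rfl
    -- The right-hand side of the rule evaluates to the operator applied to its least fixed point.
    | nat => exact (congrFun (OrderHom.map_lfp (natOperator (ArithFn 𝒞))) (v ι 0)).symm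
    | null_zero => rfl
    | null_succ => rfl

end DeductionModulo

/-- The model exists for every set of comprehension instances, so both systems are covered by the
same argument. -/
theorem mainTheorem1 :
    (∀ (Γ : List (DeductionModulo.AFormula DeductionModulo.predicative))
      (π : DeductionModulo.ProofTerm (DeductionModulo.ArithFn DeductionModulo.predicative))
      (A : DeductionModulo.AFormula DeductionModulo.predicative),
      (DeductionModulo.HA DeductionModulo.predicative).Proves Γ π A → π.SN) ∧
    (∀ (Γ : List (DeductionModulo.AFormula DeductionModulo.impredicative))
      (π : DeductionModulo.ProofTerm (DeductionModulo.ArithFn DeductionModulo.impredicative))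
      (A : DeductionModulo.AFormula DeductionModulo.impredicative),
      (DeductionModulo.HA DeductionModulo.impredicative).Proves Γ π A → π.SN) :=
  ⟨fun _ _ _ h => (DeductionModulo.arithModel_validates _).sn h,
    fun _ _ _ h => (DeductionModulo.arithModel_validates _).sn h⟩
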